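/- Let $d$ be a dimension and let $\mathbf D$ be a difference operator on complex fields over $\mathbb Z^d$, $(\mathbf Df)_\tau=\sum_{\ell=1}^k w_\ell f_{\tau-\alpha(\ell)}$ with $\alpha(\ell)\in\mathbb Z^d$, $w_\ell\in\mathbb C$. Call $\mathbf D$ regular if the vectors $\alpha(1),\dots,\alpha(k)$ span $\mathbb R^d$, all $w_\ell$ are nonzero, $\sum_\ell|w_\ell|\le 1$ and $\sum_\ell|w_\ell|\,\alpha(\ell)=0$. Write $|\tau|=\max_j|\tau_j|$, $B^t_N=\{\tau\in\mathbb Z^d:|\tau-t|\le N\}$, $B^t_N(\mathbf D)=\{\tau\in B^t_N:\tau+\alpha(\ell)\in B^t_N,\ \ell=1,\dots,k\}$, and let $\mathbf H^t_N(\mathbf D)$ be the set of fields $s:\mathbb Z^d\to\mathbb C$ with $s_\tau=(\mathbf Ds)_\tau$ for all $\tau\in B^t_N(\mathbf D)$. For reals $\theta\ge 0$, $\rho\ge 1$, $L\in\mathbb Z_{\ge0}\cup\{\infty\}$ and $t\in\mathbb Z^d$, a random field $(s_\tau)_{\tau\in\mathbb Z^d}$ is well-filtered at $t$ with parameters $\theta,\rho,L$,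 written $s\in\mathbf F^t_L(\theta,\rho)$, if for every integer $T$ with $0\le T\le L$ there is a (non-random) $q:\mathbb Z^d\to\mathbb C$ with $q_\nu=0$ for $|\nu|>T$, $\big(\sum_\nu|q_\nu|^2\big)^{1/2}\le\rho\,(2T+1)^{-d/2}$, and $$\Big[E\Big\{\Big|s_\tau-\sum_\nu q_\nu s_{\tau-\nu}\Big|^2\Big\}\Big]^{1/2}\le\theta\,(2T+1)^{-d/2}\qquad\text{for all }\tau\text{ with }|\tau-t|\le L.$$ A deterministic field is regarded as a random field that does not depend on the outcome. Proposition. Let $\mathbf D$ be a regular difference operator. Then there exists a constant $c=c(\mathbf D)>0$ such that for every integer $N>0$ and every $t\in\mathbb Z^d$, $$\mathbf H^t_N(\mathbf D)\subset\mathbf F^t_{\lfloor cN\rfloor}(0,c^{-1}).$$ -/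

import Mathlib

open MeasureTheory
open scoped ENNReal

noncomputable section

namespace WellFiltered

/-- The integer grid `ℤ^d`. -/
abbrev Grid (d : ℕ) : Type := Fin d → ℤ

/-- Deterministic complex-valued fields over `ℤ^d`. -/
abbrev Field (d : ℕ) : Type := Grid d → ℂ

/-- A random field on `ℤ^d`: `s τ ξ` is the value at the point `τ` for the outcome `ξ`. -/
abbrev RandomField (d : ℕ) (Ω : Type*) : Type _ := Grid d → Ω → ℂ

/-- `|τ| = max (|τ_1|, ..., |τ_d|)`. -/
def supNorm {d : ℕ} (τ : Grid d) : ℕ := Finset.univ.sup fun j => (τ j).natAbs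

/-- Filters: fields with finitely many nonzero entries. -/
abbrev Filt (d : ℕ) : Type := Grid d →₀ ℂ

/-- `q ∈ C_T(ℤ^d)`: the filter `q` is of order at most `T`. -/
def Filt.OrdLE {d : ℕ} (q : Filt d) (T : ℕ) : Prop := ∀ τ : Grid d, T < supNorm τ → q τ = 0

/-- The norm `|q|_2` of a filter. -/
def Filt.l2norm {d : ℕ} (q : Filt d) : ℝ := Real.sqrt (q.sum fun _ z => ‖z‖ ^ 2)

/-- The output of a filter: `(q(Δ)x)_τ = ∑_ν q_ν x_{τ-ν}`. -/
def Filt.apply {d : ℕ} (q : Filt d) (x : Field d) : Field d :=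
  fun τ => q.sum fun ν z => z * x (τ - ν)

/-- `s ∈ S^t_L(θ, ρ, T)`: the random field `s` is `T`-well-filtered, with parameters
`θ ≥ 0`, `ρ ≥ 1`, `L ∈ ℕ ∪ {∞}`, at the point `t`. The filter does not depend on the outcome. -/
def IsTWellFiltered {d : ℕ} {Ω : Type*} [MeasurableSpace Ω] (P : Measure Ω)
    (t : Grid d) (L : ℕ∞) (θ ρ : ℝ) (T : ℕ) (s : RandomField d Ω) : Prop :=
  0 ≤ θ ∧ 1 ≤ ρ ∧
  ∃ q : Filt d, q.OrdLE T ∧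
    q.l2norm ≤ ρ / (2 * (T : ℝ) + 1) ^ ((d : ℝ) / 2) ∧
    ∀ τ : Grid d, (supNorm (τ - t) : ℕ∞) ≤ L →
      (∫⁻ ξ, ‖s τ ξ - q.apply (fun ν => s ν ξ) τ‖ₑ ^ 2 ∂P) ^ (1 / 2 : ℝ)
        ≤ ENNReal.ofReal (θ * (2 * (T : ℝ) + 1) ^ (-((d : ℝ) / 2)))

/-- `F^t_L(θ, ρ)`: the random fields that are well-filtered, with parameters `θ`, `ρ`, `L`,
at the point `t`. -/
def wellFiltered {d : ℕ} {Ω : Type*} [MeasurableSpace Ω] (P : Measure Ω)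
    (t : Grid d) (L : ℕ∞) (θ ρ : ℝ) : Set (RandomField d Ω) :=
  {s | ∀ T : ℕ, (T : ℕ∞) ≤ L → IsTWellFiltered P t L θ ρ T s}

/-- The data of a difference operator `(D f)_τ = ∑_ℓ w_ℓ f_{τ - α(ℓ)}` on fields over `ℤ^d`. -/
structure DiffOp (d : ℕ) where
  /-- the number of terms -/
  k : ℕ
  /-- the shifts -/
  α : Fin k → Grid d
  /-- the weights -/
  w : Fin k → ℂ

namespace DiffOp

variable {d : ℕ} (D : DiffOp d)

/-- The action of the difference operator on fields. -/
def apply (f : Field d) : Field d := fun τ => ∑ l, D.w l * f (τ - D.α l)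

/-- A shift, viewed as a vector of `ℝ^d`. -/
def realShift (l : Fin D.k) : Fin d → ℝ := fun j => (D.α l j : ℝ)

/-- Regular difference operators. -/
structure IsRegular : Prop where
  span_eq_top : Submodule.span ℝ (Set.range D.realShift) = ⊤
  weight_ne_zero : ∀ l, D.w l ≠ 0
  sum_norm_le_one : ∑ l, ‖D.w l‖ ≤ 1
  weighted_mean_eq_zero : ∑ l, ‖D.w l‖ • D.realShift l = 0

end DiffOp

/-- The box `B^t_N = {τ : |τ - t| ≤ N}`. -/
def box {d : ℕ} (t : Grid d) (N : ℕ) : Set (Grid d) := {τ | supNorm (τ - t) ≤ N}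

/-- `B^t_N(D) = {τ ∈ B^t_N : τ + α(ℓ) ∈ B^t_N for all ℓ}`. -/
def DiffOp.innerBox {d : ℕ} (D : DiffOp d) (t : Grid d) (N : ℕ) : Set (Grid d) :=
  {τ | τ ∈ box t N ∧ ∀ l, τ + D.α l ∈ box t N}

/-- `H^t_N(D)`: the fields with `s_τ = (D s)_τ` for all `τ ∈ B^t_N(D)`. -/
def DiffOp.solutions {d : ℕ} (D : DiffOp d) (t : Grid d) (N : ℕ) : Set (Field d) :=
  {s | ∀ τ ∈ D.innerBox t N, s τ = D.apply s τ}

/-- A deterministic field, viewed as a random field that does not depend on the outcome. -/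
def Field.toRandom {d : ℕ} (Ω : Type*) (s : Field d) : RandomField d Ω := fun τ _ => s τ

end WellFiltered

end

/-!
If `s = D s` at a point, then `|s|` is there at most its average over the steps of the random walk
with weights `|w_ℓ|`, whose drift vanishes: `|s|` is subharmonic for this walk. The filters come
from a mean value inequality `|s 0| ≤ C (2T+1)^{-d} ∑_{|x| ≤ T} |s x|`, by the Riesz representation
of the evaluation `s ↦ s 0` on the restrictions of solutions to the box of radius `T`.

To prove it, let `u ≥ 0` be subharmonic and bounded by `B u(0)` on the box of radius `r`.
Subtracting a paraboloid of height of order `u(0)` and cutting off at `0` turns `u` into a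
bounded function `f` that is subharmonic up to an error `e` of order `u(0) / r²`. For a difference
`β` of two steps, replacing `f` by the mean of `f` and its translate by `β` lowers the supremum by
at most a multiple of `e`. Doing this `m` times in each of `d` independent directions `β`, with `m`
a small multiple of `r²`, therefore keeps half of `u(0)`; but it also spreads the mass, since
`m.choose j / 2 ^ m ≤ (m + 1)^{-1/2}`, and the result is at most `(m + 1)^{-d/2} ∑ u`. The bound
by `B u(0)` holds around a point that maximizes `u`, weighted by the `d`-th power of the distance
to the boundary of the box.
-/

noncomputable section

namespace WellFiltered

theorem two_mul_add_one_mul_centralBinom_sq_le (k : ℕ) :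
    (2 * k + 1) * k.centralBinom ^ 2 ≤ 16 ^ k := by
  induction k with
  | zero => simp
  | succ k ih =>
    refine le_of_mul_le_mul_left (a := (k + 1) ^ 2) ?_ (by positivity)
    calc (k + 1) ^ 2 * ((2 * (k + 1) + 1) * (k + 1).centralBinom ^ 2)
        = (2 * k + 3) * ((k + 1) * (k + 1).centralBinom) ^ 2 := by ring
      _ = 4 * (2 * k + 1) * (2 * k + 3) * ((2 * k + 1) * k.centralBinom ^ 2) := by
          rw [Nat.succ_mul_centralBinom_succ]; ring
      _ ≤ 16 * (k + 1) ^ 2 * 16 ^ k := Nat.mul_le_mul (by nlinarith) ih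
      _ = (k + 1) ^ 2 * 16 ^ (k + 1) := by ring

theorem centralBinom_succ_eq_two_mul_choose (k : ℕ) :
    (k + 1).centralBinom = 2 * (2 * k + 1).choose k := by
  rw [Nat.centralBinom, Nat.mul_succ, Nat.choose_succ_succ, Nat.choose_symm_half, ← two_mul]

theorem succ_mul_choose_sq_le (m j : ℕ) : (m + 1) * m.choose j ^ 2 ≤ 4 ^ m := by
  have le_middle : (m + 1) * m.choose j ^ 2 ≤ (m + 1) * m.choose (m / 2) ^ 2 := by
    gcongr
    exact Nat.choose_le_middle j m
  refine le_middle.trans ?_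
  obtain ⟨k, rfl | rfl⟩ := Nat.even_or_odd' m
  · rw [Nat.mul_div_cancel_left k two_pos, pow_mul]
    exact two_mul_add_one_mul_centralBinom_sq_le k
  · have bound := two_mul_add_one_mul_centralBinom_sq_le (k + 1)
    rw [centralBinom_succ_eq_two_mul_choose, pow_succ 16] at bound
    rw [show (2 * k + 1) / 2 = k by omega, pow_succ 4, pow_mul]
    norm_num
    nlinarith [Nat.zero_le ((2 * k + 1).choose k ^ 2)]

theorem choose_div_two_pow_le (m j : ℕ) : (m.choose j : ℝ) / 2 ^ m ≤ (√(m + 1))⁻¹ := by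
  rw [div_le_iff₀ (by positivity), inv_mul_eq_div, le_div_iff₀ (by positivity)]
  refine le_of_sq_le_sq ?_ (by positivity)
  rw [mul_pow, Real.sq_sqrt (by positivity), ← pow_mul, mul_comm m 2, pow_mul, mul_comm]
  norm_num
  exact_mod_cast succ_mul_choose_sq_le m j

section Smoothing

variable {G : Type*} [AddCommGroup G] {ι : Type*} [Fintype ι]

/-- The operator that translates a real function on a group, `(translate β f) x = f (x + β)`. -/
def translate (β : G) : Module.End ℝ (G → ℝ) := LinearMap.funLeft ℝ ℝ (· + β)

theorem translate_apply (β : G) (f : G → ℝ) (x : G) : translate β f x = f (x + β) := rfl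

theorem translate_mul (β γ : G) : translate β * translate γ = translate (β + γ) := by
  ext f x
  simp only [Module.End.mul_apply, translate_apply, add_assoc]

theorem translate_pow (β : G) (j : ℕ) : translate β ^ j = translate (j • β) := by
  induction j with
  | zero => ext f x; simp [translate_apply]
  | succ j ih => rw [pow_succ, ih, translate_mul, succ_nsmul]

theorem commute_translate (β γ : G) : Commute (translate β) (translate γ) := by
  rw [Commute, SemiconjBy, translate_mul, translate_mul, add_comm]

/-- The averaging operator of a walk whose steps `-α l` carry the weights `p l`. -/
def walkMean (p : ι → ℝ) (α : ι → G) : Module.End ℝ (G → ℝ) := ∑ l, p l • translate (-α l)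

/-- The mean of a function and its translate. -/
def translateMean (β : G) : Module.End ℝ (G → ℝ) := (2⁻¹ : ℝ) • (translate β + 1)

/-- Bounded nonnegative functions that are subharmonic for the walk up to the additive error `e`:
the mass of such a function cannot concentrate, because smoothing it hardly lowers its supremum. -/
structure IsSubsolution (p : ι → ℝ) (α : ι → G) (e : ℝ) (f : G → ℝ) : Prop where
  nonneg : ∀ x, 0 ≤ f x
  bddAbove : BddAbove (Set.range f)
  le : ∀ x, f x ≤ walkMean p α f x + e

/-- `β` is a difference of two steps of the walk, both of weight at least `c`. -/
def IsStepDifference (p : ι → ℝ) (α : ι → G) (c : ℝ) (β : G) : Prop :=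
  ∃ a b, a ≠ b ∧ c ≤ p a ∧ c ≤ p b ∧ α a - α b = β

variable {p : ι → ℝ} {α : ι → G} {c e : ℝ} {f g : G → ℝ} {β : G}

theorem walkMean_apply (p : ι → ℝ) (α : ι → G) (f : G → ℝ) (x : G) :
    walkMean p α f x = ∑ l, p l * f (x - α l) := by
  simp [walkMean, translate_apply, sub_eq_add_neg]

theorem walkMean_le_walkMean (hp : ∀ l, 0 ≤ p l) {x : G} (h : ∀ l, f (x - α l) ≤ g (x - α l)) :
    walkMean p α f x ≤ walkMean p α g x := by
  simp only [walkMean_apply]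
  exact Finset.sum_le_sum fun l _ => mul_le_mul_of_nonneg_left (h l) (hp l)

theorem translateMean_apply (β : G) (f : G → ℝ) (x : G) :
    translateMean β f x = (f x + f (x + β)) / 2 := by
  simp only [translateMean, LinearMap.smul_apply, LinearMap.add_apply, Module.End.one_apply,
    Pi.smul_apply, Pi.add_apply, translate_apply, smul_eq_mul]
  ring

theorem commute_translateMean_walkMean (β : G) (p : ι → ℝ) (α : ι → G) :
    Commute (translateMean β) (walkMean p α) := by
  refine Commute.smul_left (Commute.add_left ?_ (Commute.one_left _)) _
  exact Commute.sum_right _ _ _ fun l _ => (commute_translate β _).smul_right _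

theorem translateMean_pow_apply (β : G) (m : ℕ) (f : G → ℝ) (x : G) :
    (translateMean β ^ m) f x =
      ∑ j ∈ Finset.range (m + 1), (m.choose j : ℝ) / 2 ^ m * f (x + j • β) := by
  have expand : translateMean β ^ m =
      ∑ j ∈ Finset.range (m + 1), ((m.choose j : ℝ) / 2 ^ m) • translate (j • β) := by
    simp only [translateMean, smul_pow, (Commute.one_right (translate β)).add_pow, one_pow,
      mul_one, translate_pow, ← nsmul_eq_mul', Finset.smul_sum, ← Nat.cast_smul_eq_nsmul ℝ,
      smul_smul, inv_pow, smul_eq_mul, ← div_eq_mul_inv]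
  simp only [expand, LinearMap.sum_apply, LinearMap.smul_apply, Finset.sum_apply, Pi.smul_apply,
    translate_apply, smul_eq_mul]

theorem translateMean_pow_apply_le (hf : ∀ x, 0 ≤ f x) (β : G) (m : ℕ) (x : G) :
    (translateMean β ^ m) f x ≤ (√(m + 1))⁻¹ * ∑ j : Fin (m + 1), f (x + (j : ℕ) • β) := by
  rw [translateMean_pow_apply, Fin.sum_univ_eq_sum_range (fun j => f (x + j • β)), Finset.mul_sum]
  exact Finset.sum_le_sum fun j _ =>
    mul_le_mul_of_nonneg_right (choose_div_two_pow_le m j) (hf _)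

theorem IsSubsolution.map_translateMean (hf : IsSubsolution p α e f) (β : G) :
    IsSubsolution p α e (translateMean β f) where
  nonneg x := by
    rw [translateMean_apply]
    linarith [hf.nonneg x, hf.nonneg (x + β)]
  bddAbove := by
    obtain ⟨B, hB⟩ := hf.bddAbove
    rw [mem_upperBounds, Set.forall_mem_range] at hB
    refine ⟨B, Set.forall_mem_range.2 fun x => ?_⟩
    rw [translateMean_apply]
    linarith [hB x, hB (x + β)]
  le x := by
    have comm : walkMean p α (translateMean β f) x =
        translateMean β (walkMean p α f) x :=
      congrFun (LinearMap.congr_fun (commute_translateMean_walkMean β p α).eq f).symm x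
    rw [comm, translateMean_apply, translateMean_apply]
    linarith [hf.le x, hf.le (x + β)]

theorem IsSubsolution.map_pow_translateMean (hf : IsSubsolution p α e f) (β : G) (m : ℕ) :
    IsSubsolution p α e ((translateMean β ^ m) f) := by
  induction m with
  | zero => exact hf
  | succ m ih => rw [pow_succ']; exact ih.map_translateMean β

theorem walkMean_add_le_of_le (hp : ∀ l, 0 ≤ p l) (hp1 : ∑ l, p l ≤ 1) {S : ℝ} (hS : 0 ≤ S)
    (hfS : ∀ x, f x ≤ S) {a b : ι} (hab : a ≠ b) (x : G) :
    walkMean p α f x + (p a * (S - f (x - α a)) + p b * (S - f (x - α b))) ≤ S := by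
  classical
  have deficit : p a * (S - f (x - α a)) + p b * (S - f (x - α b)) ≤
      ∑ l, p l * (S - f (x - α l)) := by
    rw [← Finset.sum_pair (f := fun l => p l * (S - f (x - α l))) hab]
    exact Finset.sum_le_sum_of_subset_of_nonneg (Finset.subset_univ _) fun l _ _ =>
      mul_nonneg (hp l) (sub_nonneg.2 (hfS _))
  have total : ∑ l, p l * (S - f (x - α l)) = (∑ l, p l) * S - walkMean p α f x := by
    simp only [mul_sub, Finset.sum_sub_distrib, Finset.sum_mul, walkMean_apply]
  linarith [mul_le_of_le_one_left hS hp1]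

theorem IsSubsolution.le_of_translateMean_le (hf : IsSubsolution p α e f) (hp : ∀ l, 0 ≤ p l)
    (hp1 : ∑ l, p l ≤ 1) (hc : 0 < c) (hβ : IsStepDifference p α c β) {M : ℝ}
    (hM : ∀ x, translateMean β f x ≤ M) (x : G) : f x ≤ M + e / (2 * c) := by
  obtain ⟨a, b, hab, ha, hb, rfl⟩ := hβ
  set S := ⨆ y, f y
  have hS (y) : f y ≤ S := le_ciSup hf.bddAbove y
  -- Two of the steps from `y` end at points `β` apart, where `f` has mean at most `M`.
  have le_mix (y) : f y ≤ S - 2 * c * (S - M) + e := by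
    have two_step := walkMean_add_le_of_le (α := α) hp hp1 ((hf.nonneg x).trans (hS x)) hS hab y
    have mean_le := hM (y - α a)
    rw [translateMean_apply, sub_add_sub_cancel] at mean_le
    have weight_a := mul_le_mul_of_nonneg_right ha (sub_nonneg.2 (hS (y - α a)))
    have weight_b := mul_le_mul_of_nonneg_right hb (sub_nonneg.2 (hS (y - α b)))
    nlinarith [hf.le y]
  have : Nonempty G := ⟨x⟩
  have sup_le : S ≤ S - 2 * c * (S - M) + e := ciSup_le le_mix
  have sup_sub_le : S - M ≤ e / (2 * c) := by
    rw [le_div_iff₀ (by positivity)]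
    linarith
  linarith [hS x]

theorem IsSubsolution.le_of_pow_translateMean_le (hf : IsSubsolution p α e f)
    (hp : ∀ l, 0 ≤ p l) (hp1 : ∑ l, p l ≤ 1) (hc : 0 < c) (hβ : IsStepDifference p α c β)
    (m : ℕ) {M : ℝ} (hM : ∀ x, (translateMean β ^ m) f x ≤ M) (x : G) :
    f x ≤ M + m * (e / (2 * c)) := by
  induction m generalizing M with
  | zero => simpa using hM x
  | succ m ih =>
    have hM' := (hf.map_pow_translateMean β m).le_of_translateMean_le (M := M) hp hp1 hc hβ
      fun y => by simpa only [pow_succ', Module.End.mul_apply] using hM y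
    have := ih hM'
    push_cast
    linarith

theorem sum_translates_succ {n : ℕ} (β : Fin (n + 1) → G) (f : G → ℝ) (m : ℕ) (x : G) :
    ∑ j : Fin (n + 1) → Fin m, f (x + ∑ i, (j i : ℕ) • β i) =
      ∑ j : Fin n → Fin m, ∑ k : Fin m, f (x + ∑ i, (j i : ℕ) • β i.succ + (k : ℕ) • β 0) := by
  rw [Finset.sum_comm, ← Fintype.sum_prod_type',
    ← (Fin.consEquiv fun _ : Fin (n + 1) => Fin m).sum_comp]
  refine Fintype.sum_congr _ _ fun q => congrArg f ?_
  simp only [Fin.consEquiv_apply, Fin.sum_univ_succ, Fin.cons_zero, Fin.cons_succ]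
  abel

theorem IsSubsolution.le_of_sum_translates_le (hf : IsSubsolution p α e f) (hp : ∀ l, 0 ≤ p l)
    (hp1 : ∑ l, p l ≤ 1) (hc : 0 < c) {n : ℕ} {β : Fin n → G}
    (hβ : ∀ i, IsStepDifference p α c (β i)) (m : ℕ) {M : ℝ}
    (hM : ∀ x, (√(m + 1))⁻¹ ^ n *
      ∑ j : Fin n → Fin (m + 1), f (x + ∑ i, (j i : ℕ) • β i) ≤ M) (x : G) :
    f x ≤ M + n * (m * (e / (2 * c))) := by
  induction n generalizing f M x with
  | zero => simpa using hM x
  | succ n ih =>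
    set g := (translateMean (β 0) ^ m) f
    have hgM (y) : (√(m + 1))⁻¹ ^ n *
        ∑ j : Fin n → Fin (m + 1), g (y + ∑ i, (j i : ℕ) • β i.succ) ≤ M := by
      refine le_trans ?_ (hM y)
      rw [sum_translates_succ, pow_succ, mul_assoc, Finset.mul_sum _ _ (√(m + 1))⁻¹]
      gcongr with j
      exact translateMean_pow_apply_le hf.nonneg _ _ _
    have hg := ih (hf.map_pow_translateMean (β 0) m) (fun i => hβ i.succ) hgM
    have := hf.le_of_pow_translateMean_le hp hp1 hc (hβ 0) m hg x
    push_cast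
    linarith

theorem IsSubsolution.le_sum_of_linearIndependent (hf : IsSubsolution p α e f)
    (hp : ∀ l, 0 ≤ p l) (hp1 : ∑ l, p l ≤ 1) (hc : 0 < c) {n : ℕ} {β : Fin n → G}
    (hβ : ∀ i, IsStepDifference p α c (β i)) (hli : LinearIndependent ℕ β) (m : ℕ)
    {A : Finset G} (hA : ∀ x ∉ A, f x = 0) (x : G) :
    f x ≤ (√(m + 1))⁻¹ ^ n * ∑ y ∈ A, f y + n * (m * (e / (2 * c))) := by
  classical
  refine hf.le_of_sum_translates_le hp hp1 hc hβ m (fun z => ?_) x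
  gcongr
  let φ : (Fin n → Fin (m + 1)) → G := fun j => z + ∑ i, (j i : ℕ) • β i
  have hφ : Function.Injective φ := fun j j' h => by
    have := Fintype.linearIndependent_iffₛ.1 hli _ _ (add_left_cancel h)
    exact funext fun i => Fin.ext (this i)
  calc ∑ j, f (φ j) = ∑ y ∈ Finset.univ.image φ, f y := (Finset.sum_image hφ.injOn).symm
    _ ≤ ∑ y ∈ Finset.univ.image φ ∪ A, f y :=
        Finset.sum_le_sum_of_subset_of_nonneg Finset.subset_union_left fun _ _ _ => hf.nonneg _
    _ = ∑ y ∈ A, f y := (Finset.sum_subset Finset.subset_union_right fun y _ hy => hA y hy).symm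

end Smoothing

section Grid

variable {d : ℕ}

theorem supNorm_le_iff {τ : Grid d} {n : ℕ} : supNorm τ ≤ n ↔ ∀ j, (τ j).natAbs ≤ n := by
  simp [supNorm, Finset.sup_le_iff]

theorem natAbs_le_supNorm (τ : Grid d) (j : Fin d) : (τ j).natAbs ≤ supNorm τ :=
  supNorm_le_iff.1 le_rfl j

theorem supNorm_zero : supNorm (0 : Grid d) = 0 :=
  Nat.le_zero.1 (supNorm_le_iff.2 fun _ => by simp)

theorem supNorm_neg (τ : Grid d) : supNorm (-τ) = supNorm τ := by simp [supNorm]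

theorem supNorm_add_le (σ τ : Grid d) : supNorm (σ + τ) ≤ supNorm σ + supNorm τ :=
  supNorm_le_iff.2 fun j => (Int.natAbs_add_le _ _).trans
    (add_le_add (natAbs_le_supNorm σ j) (natAbs_le_supNorm τ j))

theorem supNorm_sub_le (σ τ : Grid d) : supNorm (σ - τ) ≤ supNorm σ + supNorm τ := by
  rw [sub_eq_add_neg, ← supNorm_neg τ]
  exact supNorm_add_le _ _

/-- The box `B^0_n` as a finite set, over which sums are taken. -/
def boxFinset (d n : ℕ) : Finset (Grid d) := Fintype.piFinset fun _ => Finset.Icc (-(n : ℤ)) n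

theorem mem_boxFinset {n : ℕ} {τ : Grid d} : τ ∈ boxFinset d n ↔ supNorm τ ≤ n := by
  rw [boxFinset, Fintype.mem_piFinset, supNorm_le_iff]
  refine forall_congr' fun j => ?_
  rw [Finset.mem_Icc]
  omega

theorem zero_mem_boxFinset (d n : ℕ) : 0 ∈ boxFinset d n :=
  mem_boxFinset.2 (supNorm_zero.trans_le n.zero_le)

theorem card_boxFinset (d n : ℕ) : (boxFinset d n).card = (2 * n + 1) ^ d := by
  simp only [boxFinset, Fintype.card_piFinset, Int.card_Icc, Finset.prod_const, Finset.card_univ,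
    Fintype.card_fin]
  congr 1
  omega

theorem sum_boxFinset_neg {M : Type*} [AddCommMonoid M] (n : ℕ) (f : Grid d → M) :
    ∑ τ ∈ boxFinset d n, f (-τ) = ∑ τ ∈ boxFinset d n, f τ :=
  Finset.sum_equiv (Equiv.neg _)
    (fun τ => by simp only [mem_boxFinset, Equiv.neg_apply, supNorm_neg]) fun _ _ => rfl

theorem sum_boxFinset_translate_le {f : Grid d → ℝ} (hf : ∀ x, 0 ≤ f x) {t : Grid d} {r n : ℕ}
    (h : supNorm t + r ≤ n) : ∑ τ ∈ boxFinset d r, f (t + τ) ≤ ∑ τ ∈ boxFinset d n, f τ := by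
  have as_map : ∑ τ ∈ boxFinset d r, f (t + τ) =
      ∑ τ ∈ (boxFinset d r).map (addLeftEmbedding t), f τ :=
    (Finset.sum_map _ (addLeftEmbedding t) f).symm
  rw [as_map]
  refine Finset.sum_le_sum_of_subset_of_nonneg (fun τ hτ => ?_) fun _ _ _ => hf _
  obtain ⟨σ, hσ, rfl⟩ := Finset.mem_map.1 hτ
  exact mem_boxFinset.2 ((supNorm_add_le t σ).trans (by have := mem_boxFinset.1 hσ; omega))

/-- The squared Euclidean norm. -/
def sqNorm (τ : Grid d) : ℝ := ∑ j, (τ j : ℝ) ^ 2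

theorem sqNorm_zero : sqNorm (0 : Grid d) = 0 := by simp [sqNorm]

theorem sqNorm_nonneg (τ : Grid d) : 0 ≤ sqNorm τ := Finset.sum_nonneg fun _ _ => sq_nonneg _

theorem sqNorm_sub (σ τ : Grid d) :
    sqNorm (σ - τ) = sqNorm σ - 2 * ∑ j, (σ j : ℝ) * τ j + sqNorm τ := by
  simp only [sqNorm, Pi.sub_apply, Int.cast_sub, sub_sq, Finset.sum_add_distrib,
    Finset.sum_sub_distrib, Finset.mul_sum, mul_assoc]

theorem supNorm_sq_le_sqNorm (τ : Grid d) : (supNorm τ : ℝ) ^ 2 ≤ sqNorm τ := by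
  rcases isEmpty_or_nonempty (Fin d) with h | h
  · simp [supNorm, sqNorm]
  · obtain ⟨j, -, hj⟩ := Finset.exists_mem_eq_sup Finset.univ Finset.univ_nonempty
      fun j => (τ j).natAbs
    rw [supNorm, hj, Nat.cast_natAbs, Int.cast_abs, sq_abs]
    exact Finset.single_le_sum (f := fun j => (τ j : ℝ) ^ 2) (fun _ _ => sq_nonneg _)
      (Finset.mem_univ j)

theorem exists_dominating_point {u : Grid d → ℝ} (hu : ∀ x, 0 ≤ u x) (n T : ℕ) :
    ∃ (x₀ : Grid d) (h : ℕ), supNorm x₀ + h = T + 1 ∧ 0 < h ∧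
      ((T : ℝ) + 1) ^ n * u 0 ≤ (h : ℝ) ^ n * u x₀ ∧
      ∀ x, 2 * supNorm x ≤ h → u (x₀ + x) ≤ 2 ^ n * u x₀ := by
  obtain ⟨x₀, hx₀, hmax⟩ := Finset.exists_max_image (boxFinset d T)
    (fun x => ((T + 1 - supNorm x : ℕ) : ℝ) ^ n * u x) ⟨0, zero_mem_boxFinset d T⟩
  rw [mem_boxFinset] at hx₀
  refine ⟨x₀, T + 1 - supNorm x₀, by omega, by omega, ?_, fun x hx => ?_⟩
  · simpa [supNorm_zero] using hmax 0 (zero_mem_boxFinset d T)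
  · have norm_add := supNorm_add_le x₀ x
    set h := T + 1 - supNorm x₀
    set h' := T + 1 - supNorm (x₀ + x)
    have height : (h : ℝ) ≤ 2 * (h' : ℝ) := by exact_mod_cast (by omega : h ≤ 2 * h')
    have h_pos : (0 : ℝ) < h := by exact_mod_cast (by omega : 0 < h)
    refine le_of_mul_le_mul_left ?_ (pow_pos h_pos n)
    calc (h : ℝ) ^ n * u (x₀ + x) ≤ (2 * (h' : ℝ)) ^ n * u (x₀ + x) := by gcongr; exact hu _
      _ = 2 ^ n * ((h' : ℝ) ^ n * u (x₀ + x)) := by rw [mul_pow, mul_assoc]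
      _ ≤ 2 ^ n * ((h : ℝ) ^ n * u x₀) := by
          gcongr 2 ^ n * ?_
          exact hmax _ (mem_boxFinset.2 (by omega))
      _ = (h : ℝ) ^ n * (2 ^ n * u x₀) := mul_left_comm _ _ _

/-- `u` lowered by the paraboloid `a |x|²` and cut off outside the box of radius `r`: if
`u ≤ a r²` near the boundary of this box, then the cutoff costs `u` only the drift of `a |x|²` in
its subharmonicity. -/
def parabolicCutoff (a : ℝ) (r : ℕ) (u : Grid d → ℝ) (x : Grid d) : ℝ :=
  if supNorm x ≤ r then max (u x - a * sqNorm x) 0 else 0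

variable {a : ℝ} {r : ℕ} {u : Grid d → ℝ}

theorem parabolicCutoff_nonneg (a : ℝ) (r : ℕ) (u : Grid d → ℝ) (x : Grid d) :
    0 ≤ parabolicCutoff a r u x := by
  unfold parabolicCutoff
  split_ifs
  exacts [le_max_right _ _, le_rfl]

theorem parabolicCutoff_eq_zero {x : Grid d} (hx : ¬ supNorm x ≤ r) :
    parabolicCutoff a r u x = 0 := if_neg hx

theorem parabolicCutoff_le (ha : 0 ≤ a) {x : Grid d} (hu : 0 ≤ u x) :
    parabolicCutoff a r u x ≤ u x := by
  unfold parabolicCutoff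
  split_ifs
  · exact max_le (sub_le_self _ (mul_nonneg ha (sqNorm_nonneg x))) hu
  · exact hu

theorem le_parabolicCutoff_add (ha : 0 ≤ a) {x : Grid d} (hu : u x ≤ a * (r : ℝ) ^ 2) :
    u x ≤ parabolicCutoff a r u x + a * sqNorm x := by
  by_cases hx : supNorm x ≤ r
  · rw [parabolicCutoff, if_pos hx, ← sub_le_iff_le_add]
    exact le_max_left _ _
  · rw [parabolicCutoff_eq_zero hx, zero_add]
    refine hu.trans (mul_le_mul_of_nonneg_left ?_ ha)
    refine le_trans ?_ (supNorm_sq_le_sqNorm x)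
    gcongr
    exact (not_le.1 hx).le

end Grid

theorem mem_span_range_sub_of_sum_smul_eq_zero {K E ι : Type*} [DivisionRing K] [AddCommGroup E]
    [Module K E] [Fintype ι] {p : ι → K} {v : ι → E} (hp : ∑ l, p l ≠ 0)
    (hv : ∑ l, p l • v l = 0) (l : ι) :
    v l ∈ Submodule.span K (Set.range fun ab : ι × ι => v ab.1 - v ab.2) := by
  rw [← Submodule.smul_mem_iff _ hp]
  have barycenter : (∑ a, p a) • v l = ∑ a, p a • (v l - v a) := by
    simp only [smul_sub, Finset.sum_sub_distrib, hv, sub_zero, Finset.sum_smul]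
  rw [barycenter]
  exact Submodule.sum_mem _ fun a _ =>
    Submodule.smul_mem _ _ (Submodule.subset_span ⟨(l, a), rfl⟩)

theorem exists_linearIndependent_sub {K E ι : Type*} [_root_.Field K] [LinearOrder K]
    [IsStrictOrderedRing K] [AddCommGroup E] [Module K E] [Fintype ι] {p : ι → K} {v : ι → E}
    (hp : ∀ l, 0 < p l) (hv : ∑ l, p l • v l = 0) (hspan : Submodule.span K (Set.range v) = ⊤) :
    ∃ a b : Fin (Module.finrank K E) → ι, LinearIndependent K fun i => v (a i) - v (b i) := by
  have span_sub : Submodule.span K (Set.range fun ab : ι × ι => v ab.1 - v ab.2) = ⊤ := by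
    rw [eq_top_iff, ← hspan, Submodule.span_le]
    exact Set.range_subset_iff.2 fun l => mem_span_range_sub_of_sum_smul_eq_zero
      (Finset.sum_pos (fun a _ => hp a) ⟨l, Finset.mem_univ l⟩).ne' hv l
  have := FiniteDimensional.span_of_finite K (Set.finite_range fun ab : ι × ι => v ab.1 - v ab.2)
  have basis := Submodule.exists_fun_fin_finrank_span_eq K
    (Set.range fun ab : ι × ι => v ab.1 - v ab.2)
  rw [span_sub, finrank_top] at basis
  obtain ⟨β, hβ, -, hli⟩ := basis
  choose ab hab using hβ
  obtain rfl : (fun i => v (ab i).1 - v (ab i).2) = β := funext hab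
  exact ⟨fun i => (ab i).1, fun i => (ab i).2, hli⟩

theorem linearIndependent_nat_of_real {d : ℕ} {κ : Type*} {β : κ → Grid d}
    (h : LinearIndependent ℝ fun i j => (β i j : ℝ)) : LinearIndependent ℕ β := by
  let toReal : Grid d →ₗ[ℕ] Fin d → ℝ :=
    ((Int.castAddHom ℝ).compLeft (Fin d)).toNatLinearMap
  refine LinearIndependent.of_comp toReal (h.restrict_scalars fun m n hmn => ?_)
  simpa using hmn

namespace DiffOp

variable {d : ℕ} {D : DiffOp d} {a : ℝ} {r : ℕ} {u : Grid d → ℝ}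

/-- The averaging operator with weights `|w_ℓ|` and steps `-α(ℓ)`, for which the modulus of a
solution of `s = D s` is subharmonic. -/
def normMean (D : DiffOp d) : Module.End ℝ (Grid d → ℝ) := walkMean (fun l => ‖D.w l‖) D.α

/-- The maximal length `|α(ℓ)|` of a shift. -/
def radius (D : DiffOp d) : ℕ := Finset.univ.sup fun l => supNorm (D.α l)

/-- The second moment of the walk with weights `|w_ℓ|`: it bounds the drift of `sqNorm`. -/
def secondMoment (D : DiffOp d) : ℝ := ∑ l, ‖D.w l‖ * sqNorm (D.α l)

theorem normMean_apply (D : DiffOp d) (f : Grid d → ℝ) (x : Grid d) :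
    D.normMean f x = ∑ l, ‖D.w l‖ * f (x - D.α l) :=
  walkMean_apply _ _ _ _

theorem normMean_translate (D : DiffOp d) (f : Grid d → ℝ) (t x : Grid d) :
    D.normMean (fun y => f (t + y)) x = D.normMean f (t + x) := by
  simp only [normMean_apply, add_sub_assoc]

theorem norm_apply_le (D : DiffOp d) (s : Field d) (x : Grid d) :
    ‖D.apply s x‖ ≤ D.normMean (fun y => ‖s y‖) x := by
  simp only [normMean_apply, ← norm_mul]
  exact norm_sum_le _ _

theorem supNorm_shift_le_radius (D : DiffOp d) (l : Fin D.k) : supNorm (D.α l) ≤ D.radius :=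
  Finset.le_sup (f := fun l => supNorm (D.α l)) (Finset.mem_univ l)

theorem supNorm_sub_shift_le (D : DiffOp d) {x : Grid d} (hx : supNorm x ≤ r) (l : Fin D.k) :
    supNorm (x - D.α l) ≤ r + D.radius :=
  (supNorm_sub_le _ _).trans (add_le_add hx (D.supNorm_shift_le_radius l))

theorem secondMoment_nonneg (D : DiffOp d) : 0 ≤ D.secondMoment :=
  Finset.sum_nonneg fun _ _ => mul_nonneg (norm_nonneg _) (sqNorm_nonneg _)

theorem IsRegular.sum_norm_mul_shift_eq_zero (hD : D.IsRegular) (j : Fin d) :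
    ∑ l, ‖D.w l‖ * (D.α l j : ℝ) = 0 := by
  simpa [realShift] using congrFun hD.weighted_mean_eq_zero j

theorem IsRegular.normMean_sqNorm_le (hD : D.IsRegular) (x : Grid d) :
    D.normMean sqNorm x ≤ sqNorm x + D.secondMoment := by
  have cross : ∑ l, ‖D.w l‖ * ∑ j, (x j : ℝ) * D.α l j = 0 := by
    simp only [Finset.mul_sum, mul_left_comm ‖D.w _‖]
    rw [Finset.sum_comm]
    simp only [← Finset.mul_sum, hD.sum_norm_mul_shift_eq_zero, mul_zero, Finset.sum_const_zero]
  calc D.normMean sqNorm x = (∑ l, ‖D.w l‖) * sqNorm x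
        - 2 * ∑ l, ‖D.w l‖ * ∑ j, (x j : ℝ) * D.α l j + D.secondMoment := by
        simp only [normMean_apply, sqNorm_sub, mul_add, mul_sub, Finset.sum_add_distrib,
          Finset.sum_sub_distrib, Finset.sum_mul, mul_left_comm ‖D.w _‖ 2, secondMoment]
        rw [Finset.mul_sum]
    _ ≤ sqNorm x + D.secondMoment := by
        rw [cross, mul_zero, sub_zero]
        gcongr
        exact mul_le_of_le_one_left (sqNorm_nonneg x) hD.sum_norm_le_one

theorem IsRegular.exists_stepDifferences (hD : D.IsRegular) :
    ∃ (c : ℝ) (β : Fin d → Grid d), 0 < c ∧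
      (∀ i, IsStepDifference (fun l => ‖D.w l‖) D.α c (β i)) ∧ LinearIndependent ℕ β := by
  have basis := exists_linearIndependent_sub (fun l => norm_pos_iff.2 (hD.weight_ne_zero l))
    hD.weighted_mean_eq_zero hD.span_eq_top
  rw [Module.finrank_fin_fun] at basis
  obtain ⟨a, b, hli⟩ := basis
  obtain ⟨⟨c, hc⟩, hcw⟩ := Finite.exists_ge fun l =>
    (⟨‖D.w l‖, norm_pos_iff.2 (hD.weight_ne_zero l)⟩ : Set.Ioi (0 : ℝ))
  refine ⟨c, fun i => D.α (a i) - D.α (b i), hc,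
    fun i => ⟨a i, b i, fun hab => ?_, hcw (a i), hcw (b i), rfl⟩, linearIndependent_nat_of_real ?_⟩
  · exact hli.ne_zero i (by rw [hab, sub_self])
  · have realShift_sub (i) : D.realShift (a i) - D.realShift (b i) =
        fun j => (((D.α (a i) - D.α (b i)) j : ℤ) : ℝ) := by
      ext j
      simp [realShift]
    simpa only [realShift_sub] using hli

theorem IsRegular.isSubsolution_parabolicCutoff (hD : D.IsRegular) (ha : 0 ≤ a)
    (hu : ∀ x, 0 ≤ u x) (hsub : ∀ x, supNorm x ≤ r → u x ≤ D.normMean u x)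
    (hua : ∀ x, supNorm x ≤ r + D.radius → u x ≤ a * (r : ℝ) ^ 2) :
    IsSubsolution (fun l => ‖D.w l‖) D.α (a * D.secondMoment) (parabolicCutoff a r u) where
  nonneg := parabolicCutoff_nonneg a r u
  bddAbove := by
    refine ⟨a * (r : ℝ) ^ 2, Set.forall_mem_range.2 fun x => ?_⟩
    by_cases hx : supNorm x ≤ r
    · exact (parabolicCutoff_le ha (hu x)).trans (hua x (by omega))
    · rw [parabolicCutoff_eq_zero hx]
      positivity
  le x := by
    set f := parabolicCutoff a r u
    have mean_nonneg : 0 ≤ D.normMean f x := by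
      rw [normMean_apply]
      exact Finset.sum_nonneg fun l _ =>
        mul_nonneg (norm_nonneg _) (parabolicCutoff_nonneg a r u _)
    have rhs_nonneg := add_nonneg mean_nonneg (mul_nonneg ha D.secondMoment_nonneg)
    by_cases hx : supNorm x ≤ r
    · have mean_le : D.normMean u x ≤ D.normMean (f + a • sqNorm) x :=
        walkMean_le_walkMean (fun l => norm_nonneg _) fun l =>
          le_parabolicCutoff_add ha (hua _ (D.supNorm_sub_shift_le hx l))
      simp only [map_add, map_smul, Pi.add_apply, Pi.smul_apply, smul_eq_mul] at mean_le
      have drift := mul_le_mul_of_nonneg_left (hD.normMean_sqNorm_le x) ha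
      simp only [f, parabolicCutoff, if_pos hx]
      refine max_le ?_ rhs_nonneg
      linarith [hsub x hx, show D.normMean f x = walkMean _ _ f x from rfl]
    · simp only [f, parabolicCutoff_eq_zero hx]
      exact rhs_nonneg

theorem IsRegular.exists_smoothing_bound (hD : D.IsRegular) :
    ∃ A : ℝ, ∀ (a : ℝ) (r : ℕ) (u : Grid d → ℝ), 0 ≤ a → (∀ x, 0 ≤ u x) →
      (∀ x, supNorm x ≤ r → u x ≤ D.normMean u x) →
      (∀ x, supNorm x ≤ r + D.radius → u x ≤ a * (r : ℝ) ^ 2) →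
      ∀ m : ℕ, u 0 ≤ (√(m + 1))⁻¹ ^ d * ∑ x ∈ boxFinset d r, u x + A * (m * a) := by
  obtain ⟨c, β, hc, hβ, hli⟩ := hD.exists_stepDifferences
  refine ⟨d * (D.secondMoment / (2 * c)), fun a r u ha hu hsub hua m => ?_⟩
  have smoothing := (hD.isSubsolution_parabolicCutoff ha hu hsub hua).le_sum_of_linearIndependent
    (fun l => norm_nonneg _) hD.sum_norm_le_one hc hβ hli m (A := boxFinset d r)
    (fun x hx => parabolicCutoff_eq_zero (mt mem_boxFinset.2 hx)) 0
  calc u 0 ≤ parabolicCutoff a r u 0 := by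
        simpa [sqNorm_zero] using le_parabolicCutoff_add ha (hua 0 (by simp [supNorm_zero]))
    _ ≤ _ := smoothing
    _ ≤ (√(m + 1))⁻¹ ^ d * ∑ x ∈ boxFinset d r, u x +
          d * (m * (a * D.secondMoment / (2 * c))) := by
        gcongr with x
        exact parabolicCutoff_le ha (hu x)
    _ = _ := by ring

theorem IsRegular.exists_mean_value_bound_of_dominated (hD : D.IsRegular) (B : ℝ) (hB : 0 ≤ B) :
    ∃ C : ℝ, 0 ≤ C ∧ ∀ (r : ℕ) (u : Grid d → ℝ), 0 < r → (∀ x, 0 ≤ u x) →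
      (∀ x, supNorm x ≤ r → u x ≤ D.normMean u x) →
      (∀ x, supNorm x ≤ r + D.radius → u x ≤ B * u 0) →
      (r : ℝ) ^ d * u 0 ≤ C * ∑ x ∈ boxFinset d r, u x := by
  obtain ⟨A, smoothing⟩ := hD.exists_smoothing_bound
  obtain ⟨E, hE⟩ := exists_nat_ge (max 1 (2 * A * B))
  rw [max_le_iff, Nat.one_le_cast] at hE
  refine ⟨2 * √E ^ d, by positivity, fun r u hr hu hsub huB => ?_⟩
  have hr2 : (0 : ℝ) < (r : ℝ) ^ 2 := by positivity
  -- Smoothing about `r ^ 2 / E` times costs at most half of `u 0`.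
  have smoothed := smoothing (B * u 0 / (r : ℝ) ^ 2) r u
    (div_nonneg (mul_nonneg hB (hu 0)) hr2.le) hu hsub
    (fun x hx => (huB x hx).trans_eq (div_mul_cancel₀ _ hr2.ne').symm) (r ^ 2 / E)
  set m := r ^ 2 / E
  set S := ∑ x ∈ boxFinset d r, u x
  have error_le : A * (m * (B * u 0 / (r : ℝ) ^ 2)) ≤ u 0 / 2 := by
    have m_le : (E : ℝ) * m ≤ (r : ℝ) ^ 2 := by exact_mod_cast Nat.mul_div_le (r ^ 2) E
    rw [mul_div_assoc', mul_div_assoc', div_le_iff₀ hr2]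
    have := mul_le_mul_of_nonneg_right
      ((mul_le_mul_of_nonneg_right hE.2 m.cast_nonneg).trans m_le) (hu 0)
    linarith
  have r_le : (r : ℝ) ≤ √E * √(m + 1) := by
    rw [← Real.sqrt_mul E.cast_nonneg]
    refine Real.le_sqrt_of_sq_le ?_
    exact_mod_cast (Nat.lt_mul_div_succ (r ^ 2) hE.1).le
  calc (r : ℝ) ^ d * u 0 ≤ (√E * √(m + 1)) ^ d * (2 * ((√(m + 1))⁻¹ ^ d * S)) := by
        gcongr
        · exact hu 0
        · linarith
    _ = 2 * √E ^ d * S := by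
        rw [mul_pow, inv_pow]
        field_simp

theorem IsRegular.exists_mean_value_bound_of_dominating_point (hD : D.IsRegular) :
    ∃ C : ℝ, 1 ≤ C ∧ ∀ (h T : ℕ) (u : Grid d → ℝ) (x₀ : Grid d), (∀ x, 0 ≤ u x) →
      (∀ x, supNorm x + D.radius ≤ T → u x ≤ D.normMean u x) → supNorm x₀ + h = T + 1 → 0 < h →
      (∀ x, 2 * supNorm x ≤ h → u (x₀ + x) ≤ 2 ^ d * u x₀) →
      (h : ℝ) ^ d * u x₀ ≤ C * ∑ x ∈ boxFinset d T, u x := by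
  obtain ⟨C, hC, dominated⟩ := hD.exists_mean_value_bound_of_dominated (2 ^ d) (by positivity)
  set K := D.radius
  refine ⟨(2 * K + 3) ^ d * (C + 1), ?_, fun h T u x₀ hu hsub hx₀ h_pos le_near => ?_⟩
  · exact one_le_mul_of_one_le_of_one_le
      (one_le_pow₀ (by linarith [K.cast_nonneg (α := ℝ)])) (by linarith)
  set S := ∑ x ∈ boxFinset d T, u x
  have S_nonneg : 0 ≤ S := Finset.sum_nonneg fun x _ => hu x
  obtain ⟨r, h_le, bound⟩ : ∃ r : ℕ, h ≤ (2 * K + 3) * r ∧ (r : ℝ) ^ d * u x₀ ≤ (C + 1) * S := by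
    rcases le_or_gt (h / 2) K with small | large
    · have le_sum : u x₀ ≤ S :=
        Finset.single_le_sum (fun x _ => hu x) (mem_boxFinset.2 (by omega))
      refine ⟨1, by omega, ?_⟩
      rw [Nat.cast_one, one_pow, one_mul]
      nlinarith
    · obtain ⟨r, hr⟩ : ∃ r, h / 2 = r + K := ⟨h / 2 - K, by omega⟩
      have local_bound := dominated r (fun x => u (x₀ + x)) (by omega) (fun x => hu _)
        (fun x hx => (hsub _ (by have := supNorm_add_le x₀ x; omega)).trans_eq
          (D.normMean_translate u x₀ x).symm)
        (fun x hx => by simpa only [add_zero] using le_near x (by omega))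
      have local_sum_le := sum_boxFinset_translate_le hu (show supNorm x₀ + r ≤ T by omega)
      refine ⟨r, by nlinarith [show h ≤ 2 * (r + K) + 1 by omega, show 0 < r by omega], ?_⟩
      rw [add_zero] at local_bound
      nlinarith
  calc (h : ℝ) ^ d * u x₀ ≤ ((2 * K + 3) * r) ^ d * u x₀ := by
        gcongr
        · exact hu x₀
        · exact_mod_cast h_le
    _ ≤ (2 * K + 3) ^ d * ((C + 1) * S) := by
        rw [mul_pow, mul_assoc]
        gcongr
    _ = _ := (mul_assoc _ _ _).symm

theorem IsRegular.exists_mean_value_bound (hD : D.IsRegular) :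
    ∃ C : ℝ, 1 ≤ C ∧ ∀ (T : ℕ) (u : Grid d → ℝ), (∀ x, 0 ≤ u x) →
      (∀ x, supNorm x + D.radius ≤ T → u x ≤ D.normMean u x) →
      (2 * (T : ℝ) + 1) ^ d * u 0 ≤ C * ∑ x ∈ boxFinset d T, u x := by
  obtain ⟨C, hC, bound⟩ := hD.exists_mean_value_bound_of_dominating_point
  refine ⟨2 ^ d * C, one_le_mul_of_one_le_of_one_le (one_le_pow₀ one_le_two) hC,
    fun T u hu hsub => ?_⟩
  obtain ⟨x₀, h, hx₀, h_pos, le_peak, le_near⟩ := exists_dominating_point hu d T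
  calc (2 * (T : ℝ) + 1) ^ d * u 0 ≤ (2 * ((T : ℝ) + 1)) ^ d * u 0 := by
        gcongr
        · exact hu 0
        · linarith
    _ = 2 ^ d * (((T : ℝ) + 1) ^ d * u 0) := by rw [mul_pow, mul_assoc]
    _ ≤ 2 ^ d * (C * ∑ x ∈ boxFinset d T, u x) := by
        gcongr 2 ^ d * ?_
        exact le_peak.trans (bound h T u x₀ hu hsub hx₀ h_pos le_near)
    _ = _ := (mul_assoc _ _ _).symm

end DiffOp

theorem exists_inner_eq_of_norm_le {𝕜 E : Type*} [RCLike 𝕜] [NormedAddCommGroup E]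
    [InnerProductSpace 𝕜 E] (W : Submodule 𝕜 E) [CompleteSpace W] (φ : E →ₗ[𝕜] 𝕜) {ρ : ℝ}
    (hρ : 0 ≤ ρ) (hφ : ∀ v ∈ W, ‖φ v‖ ≤ ρ * ‖v‖) :
    ∃ q : E, ‖q‖ ≤ ρ ∧ ∀ v ∈ W, inner 𝕜 q v = φ v := by
  let ψ : W →L[𝕜] 𝕜 := (φ.domRestrict W).mkContinuous ρ fun v => hφ v v.2
  refine ⟨(InnerProductSpace.toDual 𝕜 W).symm ψ, ?_, fun v hv => ?_⟩
  · exact ((InnerProductSpace.toDual 𝕜 W).symm.norm_map ψ).trans_le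
      (LinearMap.mkContinuous_norm_le _ hρ _)
  · exact InnerProductSpace.toDual_symm_apply (x := (⟨v, hv⟩ : W)) (y := ψ)

section Reproducing

variable {d : ℕ}

theorem exists_filt_of_norm_le (V : Submodule ℂ (Field d)) {A : Finset (Grid d)} (hA : 0 ∈ A)
    {ρ : ℝ} (hρ : 0 ≤ ρ) (hV : ∀ s ∈ V, ‖s 0‖ ≤ ρ * √(∑ ν ∈ A, ‖s (-ν)‖ ^ 2)) :
    ∃ q : Filt d, (∀ ν ∉ A, q ν = 0) ∧ q.l2norm ≤ ρ ∧ ∀ s ∈ V, q.apply s 0 = s 0 := by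
  let Λ : Field d →ₗ[ℂ] EuclideanSpace ℂ A :=
    (WithLp.linearEquiv 2 ℂ (A → ℂ)).symm.toLinearMap ∘ₗ
      LinearMap.funLeft ℂ ℂ fun ν : A => -(ν : Grid d)
  have norm_Λ (s : Field d) : ‖Λ s‖ = √(∑ ν ∈ A, ‖s (-ν)‖ ^ 2) := by
    rw [EuclideanSpace.norm_eq, ← Finset.sum_coe_sort A fun ν => ‖s (-ν)‖ ^ 2]
    rfl
  obtain ⟨v, hv, hrep⟩ := exists_inner_eq_of_norm_le (V.map Λ)
    (EuclideanSpace.projₗ (𝕜 := ℂ) (⟨0, hA⟩ : A)) hρ (by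
      rintro _ ⟨s, hs, rfl⟩
      rw [norm_Λ]
      simpa [Λ] using hV s hs)
  let q : Filt d := Finsupp.embDomain (Function.Embedding.subtype (· ∈ A))
    (Finsupp.equivFunOnFinite.symm fun ν => starRingEnd ℂ (v ν))
  refine ⟨q, fun ν hν => Finsupp.embDomain_of_notMem_range _ _ _ (by simpa using hν), ?_,
    fun s hs => ?_⟩
  · refine le_trans (le_of_eq ?_) hv
    simp [Filt.l2norm, q, Finsupp.sum_embDomain, Finsupp.sum_fintype, EuclideanSpace.norm_eq]
  · have := hrep (Λ s) (Submodule.mem_map_of_mem hs)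
    simpa [Filt.apply, q, Finsupp.sum_embDomain, Finsupp.sum_fintype, PiLp.inner_apply, Λ,
      mul_comm] using this

theorem Filt.apply_translate (q : Filt d) (s : Field d) (τ : Grid d) :
    q.apply (fun x => s (τ + x)) 0 = q.apply s τ := by
  simp only [Filt.apply, zero_sub, ← sub_eq_add_neg]

namespace DiffOp

variable {D : DiffOp d}

/-- The set `D.solutions t N`, which is a linear subspace of the space of fields. -/
def solutionSubmodule (D : DiffOp d) (t : Grid d) (N : ℕ) : Submodule ℂ (Field d) where
  carrier := D.solutions t N
  zero_mem' := fun x _ => by simp [DiffOp.apply]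
  add_mem' := fun {s s'} hs hs' x hx => by
    simp only [DiffOp.apply, Pi.add_apply, mul_add, Finset.sum_add_distrib, hs x hx, hs' x hx]
  smul_mem' := fun z s hs x hx => by
    simp only [DiffOp.apply, Pi.smul_apply, smul_eq_mul, hs x hx, Finset.mul_sum, mul_left_comm z]

theorem mem_innerBox_zero {T : ℕ} {x : Grid d} (hx : supNorm x + D.radius ≤ T) :
    x ∈ D.innerBox 0 T := by
  simp only [innerBox, box, Set.mem_ofPred_eq, sub_zero]
  refine ⟨by omega, fun l => ?_⟩
  have := supNorm_add_le x (D.α l)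
  have := D.supNorm_shift_le_radius l
  omega

theorem translate_mem_solutions {t τ : Grid d} {N T : ℕ} {s : Field d} (hs : s ∈ D.solutions t N)
    (h : supNorm (τ - t) + T ≤ N) : (fun x => s (τ + x)) ∈ D.solutions 0 T := by
  have add_mem_box {x : Grid d} (hx : x ∈ box 0 T) : τ + x ∈ box t N := by
    simp only [box, Set.mem_ofPred_eq, sub_zero] at hx ⊢
    rw [add_sub_right_comm]
    exact (supNorm_add_le _ _).trans (by omega)
  rintro x ⟨hx, hxα⟩
  have solves := hs (τ + x) ⟨add_mem_box hx, fun l => by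
    rw [add_assoc]
    exact add_mem_box (hxα l)⟩
  simpa only [DiffOp.apply, add_sub_assoc] using solves

theorem IsRegular.exists_norm_zero_le (hD : D.IsRegular) :
    ∃ C : ℝ, 1 ≤ C ∧ ∀ T, ∀ s ∈ D.solutions 0 T,
      ‖s 0‖ ≤ C / (2 * (T : ℝ) + 1) ^ ((d : ℝ) / 2) * √(∑ x ∈ boxFinset d T, ‖s x‖ ^ 2) := by
  obtain ⟨C, hC, mean_value⟩ := hD.exists_mean_value_bound
  refine ⟨C, hC, fun T s hs => ?_⟩
  have subharmonic (x : Grid d) (hx : supNorm x + D.radius ≤ T) :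
      ‖s x‖ ≤ D.normMean (fun y => ‖s y‖) x := by
    rw [hs x (mem_innerBox_zero hx)]
    exact D.norm_apply_le s x
  have l1_bound := mean_value T (fun x => ‖s x‖) (fun x => norm_nonneg _) subharmonic
  have cauchy_schwarz : ∑ x ∈ boxFinset d T, ‖s x‖ ≤
      √((2 * (T : ℝ) + 1) ^ d) * √(∑ x ∈ boxFinset d T, ‖s x‖ ^ 2) := by
    rw [← Real.sqrt_mul (by positivity)]
    refine Real.le_sqrt_of_sq_le (sq_sum_le_card_mul_sum_sq.trans_eq ?_)
    rw [card_boxFinset]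
    norm_cast
  have pow_half : (2 * (T : ℝ) + 1) ^ ((d : ℝ) / 2) = √((2 * (T : ℝ) + 1) ^ d) := by
    rw [Real.sqrt_eq_rpow, ← Real.rpow_natCast_mul (by positivity), mul_one_div]
  rw [pow_half, div_mul_eq_mul_div, le_div_iff₀ (by positivity)]
  set X := (2 * (T : ℝ) + 1) ^ d
  refine le_of_mul_le_mul_left ?_ (show 0 < √X by positivity)
  calc √X * (‖s 0‖ * √X) = X * ‖s 0‖ := by
        rw [mul_left_comm, Real.mul_self_sqrt (by positivity), mul_comm]
    _ ≤ C * (√X * √(∑ x ∈ boxFinset d T, ‖s x‖ ^ 2)) := l1_bound.trans (by gcongr)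
    _ = _ := mul_left_comm _ _ _

theorem IsRegular.exists_reproducing_filter (hD : D.IsRegular) :
    ∃ C : ℝ, 1 ≤ C ∧ ∀ T : ℕ, ∃ q : Filt d, q.OrdLE T ∧
      q.l2norm ≤ C / (2 * (T : ℝ) + 1) ^ ((d : ℝ) / 2) ∧
      ∀ (t τ : Grid d) (N : ℕ), supNorm (τ - t) + T ≤ N →
        ∀ s ∈ D.solutions t N, q.apply s τ = s τ := by
  obtain ⟨C, hC, bound⟩ := hD.exists_norm_zero_le
  refine ⟨C, hC, fun T => ?_⟩
  obtain ⟨q, hq, hqC, hrep⟩ := exists_filt_of_norm_le (D.solutionSubmodule 0 T)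
    (zero_mem_boxFinset d T) (ρ := C / (2 * (T : ℝ) + 1) ^ ((d : ℝ) / 2)) (by positivity)
    fun s hs => by
      rw [sum_boxFinset_neg T fun x => ‖s x‖ ^ 2]
      exact bound T s hs
  refine ⟨q, fun ν hν => hq ν (by rw [mem_boxFinset]; omega), hqC, fun t τ N hτ s hs => ?_⟩
  simpa only [Filt.apply_translate, add_zero] using hrep _ (translate_mem_solutions hs hτ)

end DiffOp

end Reproducing

end WellFiltered

end

theorem mainTheorem3_general {d : ℕ} (D : WellFiltered.DiffOp d) (hD : D.IsRegular) :
    ∃ c : ℝ, 0 < c ∧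
      ∀ (N : ℕ) (t : WellFiltered.Grid d) (Ω : Type*) [MeasurableSpace Ω]
        (P : MeasureTheory.Measure Ω) (s : WellFiltered.RandomField d Ω),
          (∀ᵐ ξ ∂P, (fun τ => s τ ξ) ∈ D.solutions t N) →
            s ∈ WellFiltered.wellFiltered P t ((⌊c * (N : ℝ)⌋₊ : ℕ) : ℕ∞) 0 c⁻¹ := by
  obtain ⟨C, hC, filters⟩ := hD.exists_reproducing_filter
  refine ⟨(2 * C)⁻¹, by positivity, fun N t Ω _ P s hs T hT => ?_⟩
  obtain ⟨q, hqT, hqC, reproduces⟩ := filters T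
  have floor_le_half : ⌊(2 * C)⁻¹ * (N : ℝ)⌋₊ ≤ N / 2 := by
    rw [← Nat.floor_div_eq_div (K := ℝ), Nat.cast_ofNat, inv_mul_eq_div]
    gcongr
    linarith
  rw [inv_inv]
  refine ⟨le_rfl, by linarith, q, hqT, hqC.trans (by gcongr; linarith), fun τ hτ => ?_⟩
  rw [Nat.cast_le] at hT hτ
  have error_zero : ∀ᵐ ξ ∂P, ‖s τ ξ - q.apply (fun ν => s ν ξ) τ‖ₑ ^ 2 = 0 := by
    filter_upwards [hs] with ξ hξ
    rw [reproduces t τ N (by omega) _ hξ, sub_self, enorm_zero, zero_pow two_ne_zero]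
  rw [MeasureTheory.lintegral_eq_zero_of_ae_eq_zero error_zero]
  simp

theorem mainTheorem3 {d : ℕ} (D : WellFiltered.DiffOp d) (hD : D.IsRegular) :
    ∃ c : ℝ, 0 < c ∧
      ∀ N : ℕ, 0 < N → ∀ t : WellFiltered.Grid d, ∀ s ∈ D.solutions t N,
        ∀ (Ω : Type*) [MeasurableSpace Ω] (P : MeasureTheory.Measure Ω)
          [MeasureTheory.IsProbabilityMeasure P],
          WellFiltered.Field.toRandom Ω s ∈
            WellFiltered.wellFiltered P t ((⌊c * (N : ℝ)⌋₊ : ℕ) : ℕ∞) 0 c⁻¹ := by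
  obtain ⟨c, hc, well_filtered⟩ := mainTheorem3_general D hD
  exact ⟨c, hc, fun N _ t s hs Ω _ P _ => well_filtered N t Ω P _ (.of_forall fun _ => hs)⟩
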